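/- **Theorem (Adequacy).** *Setting.* Let $\mathrm{Any}$ be the type of all values. A function body is an interaction tree with results in $\mathrm{Any}$ that may trigger the events $\mathrm{Choose}(X)$ and $\mathrm{Take}(X)$ (answered in $X$), $\mathrm{Obs}\,f\,x$ (observable event) and $\mathrm{Call}\,f\,x$ (answered in $\mathrm{Any}$), $\mathrm{Get}$, $\mathrm{Put}\,a$ (access to the module-local state, a value in $\mathrm{Any}$) and $\mathrm{GetCaller}$ (the name of the calling module). A module semantics consists of a name, an initial local state and a finite partial map from function names to functions from arguments in $\mathrm{Any}$ to bodies. Let $LD$ be a partial commutative monoid (a commutative monoid with a validity predicate that holds at the unit and passes from $a+b$ to $a$). A module $M$ consists of loading data $\ell_M\in LD$ and a map $d\mapsto M(d)$ from $LD$ to module semantics; programs are lists of modules, and linking $\circ$ is concatenation of lists. *Behaviors.* A trace is a finite or infinite sequence of observable events (each with its answer); a finite one ends in termination with a value, silent divergence, error, or partial termination. A program $P$ is loaded with $d=\sum_{M\in P}\ell_M$ and executed from a call of a given main function with a given argument (and a given caller name reported to it), using a call stack and one local state per module. Loading is a fatal error if $d$ is not valid or a module name or function name is defined twice; calling an undefined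 function is a fatal error. $\mathrm{Beh}(P)$ is the set of possible traces: partial termination is possible at any point, $\mathrm{Choose}$ gives the union and $\mathrm{Take}$ the intersection over all answers, the answers to $\mathrm{Obs}$ are arbitrary, and a fatal error (a $\mathrm{Take}$ from the empty set) has all traces. For programs, $P_i\le_{\mathrm{ctx}}P_a$ means $\mathrm{Beh}(C\circ P_i)\subseteq\mathrm{Beh}(C\circ P_a)$ for every program $C$. *Simulation.* Let $(W,\sqsubseteq)$ be a preorder and $J$ a relation between worlds $w\in W$, implementation states and abstraction states. For a caller name $c$ and a world $w$, let $\lesssim_w$ be the greatest relation between pairs $(s_i,t_i)$, $(s_a,t_a)$ of a local state and a body that is justified by the following rules. 1. Both bodies return the same value, and $J\,w'\,s_i\,s_a$ for some $w'\sqsupseteq w$. 2. Both bodies trigger the same $\mathrm{Call}\,f\,x$, and for some $w'\sqsupseteq w$ we have $J\,w'\,s_i\,s_a$, and for all $r$, $w''\sqsupseteq w'$ and $s_i',s_a'$ with $J\,w''\,s_i'\,s_a'$ the continuations at $r$ with states $s_i',s_a'$ are related by $\lesssim_w$. 3. Both bodies trigger the same $\mathrm{Obs}\,f\,x$, and the continuations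 are related for all answers. 4. One side alone takes a silent, $\mathrm{Get}$, $\mathrm{Put}$ or $\mathrm{GetCaller}$ step (the last is answered by $c$), and the results are related. 5. One side alone triggers $\mathrm{Choose}(X)$ or $\mathrm{Take}(X)$, and the results are related for all $x\in X$ ($\mathrm{Choose}$ of the implementation, $\mathrm{Take}$ of the abstraction), respectively for some $x\in X$ ($\mathrm{Take}$ of the implementation, $\mathrm{Choose}$ of the abstraction). The relation carries two ordinal stuttering indices, one per side. When a side moves alone by 4 or 5, the index of that side strictly decreases and the index of the other side may be reset arbitrarily; in 2 and 3 both may be reset arbitrarily. Two pairs are related if they are related with some indices. *Statement.* Let $M_i$ and $M_a$ be modules with $\ell_{M_i}=\ell_{M_a}=:\ell$, let $(W,\sqsubseteq)$ be a preorder, and let $I_d$ be, for each $d\in LD$, a relation between worlds, implementation states and abstraction states. Suppose that for every valid $d$ of the form $\ell+e$ with $e\in LD$: * $M_i(d)$ and $M_a(d)$ have the same name and define the same function names; * their initial local states are related by $I_d$ at some world; * for every function name $f$ that they define, with semantics $f_i$ and $f_a$, and for all callers $c$, arguments $x$, worlds $w$ and local states with $I_d\,w\,s_i\,s_a$, we have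 $(s_i,f_i(x))\lesssim_w(s_a,f_a(x))$ (the simulation for $J=I_d$ and $c$). Then, for every choice of the main function, its argument and its reported caller, $[M_i]\le_{\mathrm{ctx}}[M_a]$. -/

import Mathlib

universe u v w

namespace AL

/-! ### Interaction trees -/

/-- Node labels of an interaction tree: return a value, take a silent step, or trigger an event
`e : E X` whose answer is an element of `X`. -/
inductive ITree.Shape (E : Type u → Type v) (R : Type w) : Type (max (u + 1) v w)
  | ret (r : R)
  | tau
  | vis (X : Type u) (e : E X)

/-- The polynomial functor of which interaction trees are the final coalgebra. -/
def ITree.functor (E : Type u → Type v) (R : Type w) : PFunctor.{max (u + 1) v w, u} where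
  A := ITree.Shape E R
  B
    | .ret _ => PEmpty
    | .tau => PUnit
    | .vis X _ => X

/-- Interaction trees with events in `E` and results in `R`: the coinductive type generated by
`ret`, `tau` and `vis`. -/
def ITree (E : Type u → Type v) (R : Type w) : Type (max (u + 1) v w) :=
  (ITree.functor E R).M

/-- One layer of an interaction tree. -/
inductive ITree.View (E : Type u → Type v) (R : Type w) : Type (max (u + 1) v w)
  | ret (r : R)
  | tau (t : ITree E R)
  | vis (X : Type u) (e : E X) (k : X → ITree E R)

namespace ITree

variable {E : Type u → Type v} {R : Type w}

/-- The presentation of a layer as a `View`. -/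
def View.ofObj : (functor E R).Obj (ITree E R) → View E R
  | ⟨.ret r, _⟩ => .ret r
  | ⟨.tau, f⟩ => .tau (f PUnit.unit)
  | ⟨.vis X e, f⟩ => .vis X e f

/-- The root of a tree together with its subtrees. -/
def observe (t : ITree E R) : View E R :=
  View.ofObj (PFunctor.M.dest t)

/-- The tree that returns `r`. -/
def ret (r : R) : ITree E R :=
  PFunctor.M.mk (F := functor E R) ⟨.ret r, fun x => PEmpty.elim x⟩

/-- The tree that takes a silent step and continues as `t`. -/
def tau (t : ITree E R) : ITree E R :=
  PFunctor.M.mk (F := functor E R) ⟨.tau, fun _ => t⟩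

/-- The tree that triggers `e` and continues as `k x` on the answer `x`. -/
def vis {X : Type u} (e : E X) (k : X → ITree E R) : ITree E R :=
  PFunctor.M.mk (F := functor E R) ⟨.vis X e, k⟩

@[simp] theorem observe_ret (r : R) : (ret r : ITree E R).observe = .ret r :=
  congrArg View.ofObj (PFunctor.M.dest_mk _)

@[simp] theorem observe_tau (t : ITree E R) : (tau t).observe = .tau t :=
  congrArg View.ofObj (PFunctor.M.dest_mk _)

@[simp] theorem observe_vis {X : Type u} (e : E X) (k : X → ITree E R) :
    (vis e k).observe = .vis X e k :=
  congrArg View.ofObj (PFunctor.M.dest_mk _)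

end ITree

/-! ### Executable module semantics -/

/-- The type of all values: a value of any type, tagged with its type. -/
def Any : Type (u + 1) := Σ T : Type u, T

/-- The embedding of an arbitrary type into `Any`. -/
def Any.upcast {T : Type u} (x : T) : Any.{u} := ⟨T, x⟩

/-- The events of a module function: the primitive events `choose`, `take`, `obs`, and function
calls, access to the module-local state and to the name of the calling module. -/
inductive EmsE : Type (u + 1) → Type (u + 2)
  | choose (X : Type (u + 1)) : EmsE X
  | take (X : Type (u + 1)) : EmsE X
  | obs (fn : String) (args : Any.{u}) : EmsE Any.{u}
  | call (fn : String) (args : Any.{u}) : EmsE Any.{u}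
  | get : EmsE Any.{u}
  | put (a : Any.{u}) : EmsE PUnit
  | getCaller : EmsE (ULift String)

/-- The code of a function body. -/
abbrev Code : Type (u + 2) := ITree EmsE.{u} Any.{u}

/-- The semantics of a function: it maps an argument to the tree that is executed. -/
abbrev Fundef : Type (u + 2) := Any.{u} → Code.{u}

/-- The semantics of a module: its name, its initial local state and a finite partial map from
function names to function semantics. -/
structure EMS : Type (u + 2) where
  name : String
  init : Any.{u}
  funs : String → Option Fundef.{u}
  finite_funs : {fn | (funs fn).isSome}.Finite

/-- Partial commutative monoids, presented by a total addition and a validity predicate. -/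
class PCM (M : Type v) extends AddCommMonoid M where
  valid : M → Prop
  valid_zero : valid 0
  valid_of_add : ∀ a b : M, valid (a + b) → valid a

/-- A module code: its own loading data, and its semantics as a function of the global loading
data. -/
structure Mod (LD : Type v) : Type (max (u + 2) v) where
  ld : LD
  sem : LD → EMS.{u}

/-- Modules codes; linking is `++`. -/
abbrev Mods (LD : Type v) : Type (max (u + 2) v) := List (Mod.{u} LD)

/-- The combined loading data of all modules. -/
def Mods.ld {LD : Type v} [PCM LD] (P : Mods.{u} LD) : LD := (P.map Mod.ld).sum

/-- The module semantics that result from loading. -/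
def Mods.load {LD : Type v} [PCM LD] (P : Mods.{u} LD) : List EMS.{u} :=
  P.map fun m => m.sem P.ld

/-- Modules codes can be loaded together: their loading data are consistent, and no module name
and no function name is defined twice. -/
structure Mods.Wf {LD : Type v} [PCM LD] (P : Mods.{u} LD) : Prop where
  valid_ld : PCM.valid P.ld
  names : P.load.Pairwise fun m m' => m.name ≠ m'.name
  funs : P.load.Pairwise fun m m' => ∀ fn, m.funs fn = none ∨ m'.funs fn = none

/-! ### Traces and behaviors -/

/-- An observable event `obs fn args` together with the answer `res` of the environment. -/
structure ObsEvent : Type (u + 1) where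
  fn : String
  args : Any.{u}
  res : Any.{u}

/-- Node labels of traces. -/
inductive Trace.Shape : Type (u + 1)
  | cons (e : ObsEvent.{u})
  | term (v : Any.{u})
  | diverge
  | error
  | stopped

/-- The polynomial functor of which traces are the final coalgebra. -/
def Trace.functor : PFunctor.{u + 1, 0} where
  A := Trace.Shape.{u}
  B
    | .cons _ => Unit
    | _ => Empty

/-- Traces: finite or infinite sequences of observable events, a finite one being ended by normal
termination with a value, silent divergence, a fatal error, or partial termination
(`stopped`). -/
def Trace : Type (u + 1) := Trace.functor.{u}.M

namespace Trace

/-- A trace that starts with an observable event. -/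
def cons (e : ObsEvent.{u}) (tr : Trace.{u}) : Trace.{u} :=
  PFunctor.M.mk (F := functor) ⟨.cons e, fun _ => tr⟩

/-- Normal termination. -/
def term (v : Any.{u}) : Trace.{u} :=
  PFunctor.M.mk (F := functor) ⟨.term v, fun x => Empty.elim x⟩

/-- Divergence without observable events. -/
def diverge : Trace.{u} :=
  PFunctor.M.mk (F := functor) ⟨.diverge, fun x => Empty.elim x⟩

/-- Fatal error. -/
def error : Trace.{u} :=
  PFunctor.M.mk (F := functor) ⟨.error, fun x => Empty.elim x⟩

/-- Partial termination. -/
def stopped : Trace.{u} :=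
  PFunctor.M.mk (F := functor) ⟨.stopped, fun x => Empty.elim x⟩

end Trace

/-- What an execution does in a state: it has terminated, it moves silently to a successor chosen
by the system (`demonic`) or taken by the environment (`angelic`), or it performs an observable
event and continues with the answer. -/
inductive Move (S : Type v) : Type (max (u + 2) v)
  | final (v : Any.{u})
  | demonic (X : Type (u + 1)) (next : X → S)
  | angelic (X : Type (u + 1)) (next : X → S)
  | obs (fn : String) (args : Any.{u}) (next : Any.{u} → S)

/-- A deterministic silent step. -/
def Move.silent {S : Type v} (s : S) : Move.{u} S := .demonic PUnit fun _ => s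

section Behavior

variable {S : Type v} (move : S → Move.{u} S)

/-- One unfolding of silent divergence. -/
inductive SpinF (R : S → Prop) : S → Prop
  | demonic {s : S} {X : Type (u + 1)} {next : X → S} (hs : move s = .demonic X next)
      (x : X) (h : R (next x)) : SpinF R s
  | angelic {s : S} {X : Type (u + 1)} {next : X → S} (hs : move s = .angelic X next)
      (h : ∀ x, R (next x)) : SpinF R s

/-- Silent divergence: the greatest fixed point of `SpinF`. -/
def Spin (s : S) : Prop :=
  ∃ R : S → Prop, (∀ s, R s → SpinF move R s) ∧ R s

/-- The behaviors of a state up to and including the next observable event, after which the rest of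
the trace is described by `R`. Demonic moves give unions and angelic moves give intersections. An
angelic move without successors therefore has all traces, among them `Trace.error`, and a demonic
move without successors only `Trace.stopped`. -/
inductive BehF (R : S → Trace.{u} → Prop) : S → Trace.{u} → Prop
  | term {s : S} {v : Any.{u}} (hs : move s = .final v) : BehF R s (.term v)
  | diverge {s : S} (hs : Spin move s) : BehF R s .diverge
  | stopped {s : S} : BehF R s .stopped
  | obs {s : S} {fn : String} {args : Any.{u}} {next : Any.{u} → S}
      (hs : move s = .obs fn args next) (res : Any.{u}) (tr : Trace.{u})
      (h : R (next res) tr) : BehF R s (.cons ⟨fn, args, res⟩ tr)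
  | demonic {s : S} {X : Type (u + 1)} {next : X → S} {tr : Trace.{u}}
      (hs : move s = .demonic X next) (x : X) (h : BehF R (next x) tr) : BehF R s tr
  | angelic {s : S} {X : Type (u + 1)} {next : X → S} {tr : Trace.{u}}
      (hs : move s = .angelic X next) (h : ∀ x, BehF R (next x) tr) : BehF R s tr

/-- The traces of a state: the greatest fixed point of `BehF`. -/
def Behaves (s : S) (tr : Trace.{u}) : Prop :=
  ∃ R : S → Trace.{u} → Prop, (∀ s tr, R s tr → BehF move R s tr) ∧ R s tr

end Behavior

/-! ### Execution of loaded modules -/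

/-- A suspended caller: its module, the name of the module that called it, and its continuation. -/
structure Frame : Type (u + 2) where
  modName : String
  caller : String
  cont : Any.{u} → Code.{u}

/-- States of an execution: a fatal error, or the running code with its module, its caller, the
call stack and the local states of all modules (indexed by module names). -/
inductive State : Type (u + 2)
  | error
  | run (modName caller : String) (code : Code.{u}) (stack : List Frame.{u})
      (store : String → Any.{u})

/-- The function `fn` of a list of modules, with the name of the module that defines it. -/
def findFun (P : List EMS.{u}) (fn : String) : Option (String × Fundef.{u}) :=
  P.findSome? fun m => (m.funs fn).map fun f => (m.name, f)

/-- The state after a call of `fn`; calling an undefined function is a fatal error. -/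
def invoke (P : List EMS.{u}) (caller fn : String) (args : Any.{u}) (stack : List Frame.{u})
    (store : String → Any.{u}) : State.{u} :=
  match findFun P fn with
  | none => .error
  | some (modName, f) => .run modName caller (f args) stack store

/-- The local states before execution (names of absent modules get a dummy value). -/
def initStore (P : List EMS.{u}) (name : String) : Any.{u} :=
  match P.find? fun m => m.name = name with
  | none => Any.upcast PUnit.unit
  | some m => m.init

/-- The moves of an execution. A fatal error is an angelic move without successors. -/
def State.move (P : List EMS.{u}) : State.{u} → Move.{u} State.{u}
  | .error => .angelic PEmpty fun x => PEmpty.elim x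
  | .run modName caller code stack store =>
    match code.observe with
    | .ret v =>
      match stack with
      | [] => .final v
      | F :: stack => .silent (.run F.modName F.caller (F.cont v) stack store)
    | .tau t => .silent (.run modName caller t stack store)
    | .vis _ (.choose X) k => .demonic X fun x => .run modName caller (k x) stack store
    | .vis _ (.take X) k => .angelic X fun x => .run modName caller (k x) stack store
    | .vis _ (.obs fn args) k => .obs fn args fun r => .run modName caller (k r) stack store
    | .vis _ (.call fn args) k =>
      .silent (invoke P modName fn args (⟨modName, caller, k⟩ :: stack) store)
    | .vis _ .get k => .silent (.run modName caller (k (store modName)) stack store)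
    | .vis _ (.put a) k =>
      .silent (.run modName caller (k PUnit.unit) stack (Function.update store modName a))
    | .vis _ .getCaller k => .silent (.run modName caller (k ⟨caller⟩) stack store)

/-- The call that starts a program: the name and the argument of the main function, and the caller
name that is reported to it. -/
structure MainCall : Type (u + 1) where
  caller : String
  fn : String
  args : Any.{u}

open Classical in
/-- The state in which a program starts; loading ill-formed modules codes is a fatal error. -/
noncomputable def Mods.start {LD : Type v} [PCM LD] (main : MainCall.{u}) (P : Mods.{u} LD) :
    State.{u} :=
  if P.Wf then invoke P.load main.caller main.fn main.args [] (initStore P.load) else .error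

/-- The set of traces that can arise when modules codes are loaded and executed. -/
def Mods.Beh {LD : Type v} [PCM LD] (main : MainCall.{u}) (P : Mods.{u} LD) : Set Trace.{u} :=
  {tr | Behaves (State.move P.load) (P.start main) tr}

/-- Contextual refinement. -/
def CtxRefines {LD : Type v} [PCM LD] (main : MainCall.{u}) (Pi Pa : Mods.{u} LD) : Prop :=
  ∀ C : Mods.{u} LD, Mods.Beh main (C ++ Pi) ⊆ Mods.Beh main (C ++ Pa)

/-! ### Simulation -/

/-- The deterministic silent steps of a function, on pairs of a module-local state and code, when
it was called from the module `caller`. -/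
inductive LocalStep (caller : String) : Any.{u} × Code.{u} → Any.{u} × Code.{u} → Prop
  | tau {st : Any.{u}} {t t' : Code.{u}} (h : t.observe = .tau t') :
      LocalStep caller (st, t) (st, t')
  | get {st : Any.{u}} {t : Code.{u}} {k : Any.{u} → Code.{u}}
      (h : t.observe = .vis _ .get k) : LocalStep caller (st, t) (st, k st)
  | put {st a : Any.{u}} {t : Code.{u}} {k : PUnit → Code.{u}}
      (h : t.observe = .vis _ (.put a) k) : LocalStep caller (st, t) (a, k PUnit.unit)
  | getCaller {st : Any.{u}} {t : Code.{u}} {k : ULift String → Code.{u}}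
      (h : t.observe = .vis _ .getCaller k) : LocalStep caller (st, t) (st, k ⟨caller⟩)

section Simulation

variable {W : Type w} [Preorder W] (I : W → Any.{u} → Any.{u} → Prop) (caller : String) (w₀ : W)

/-- One unfolding of the simulation at the world `w₀` between an implementation (suffix `i`) and an
abstraction (suffix `a`), for functions called from the module `caller`. The ordinals `p` and `q`
are stuttering indices: `p` strictly decreases whenever the implementation moves alone and `q` whenever the
abstraction moves alone, so that neither side can move alone forever. -/
inductive SimF
    (R : Ordinal.{u + 1} → Ordinal.{u + 1} → Any.{u} × Code.{u} → Any.{u} × Code.{u} → Prop)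
    (p q : Ordinal.{u + 1}) : Any.{u} × Code.{u} → Any.{u} × Code.{u} → Prop
  | ret {si sa : Any.{u}} {ti ta : Code.{u}} {r : Any.{u}}
      (hi : ti.observe = .ret r) (ha : ta.observe = .ret r)
      (w₁ : W) (hw : w₀ ≤ w₁) (hI : I w₁ si sa) :
      SimF R p q (si, ti) (sa, ta)
  | call {si sa : Any.{u}} {ti ta : Code.{u}} {fn : String} {args : Any.{u}}
      {ki ka : Any.{u} → Code.{u}}
      (hi : ti.observe = .vis _ (.call fn args) ki) (ha : ta.observe = .vis _ (.call fn args) ka)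
      (w₁ : W) (hw : w₀ ≤ w₁) (hI : I w₁ si sa)
      (h : ∀ (r : Any.{u}) (w₂ : W) (si' sa' : Any.{u}), w₁ ≤ w₂ → I w₂ si' sa' →
        ∃ p' q', R p' q' (si', ki r) (sa', ka r)) :
      SimF R p q (si, ti) (sa, ta)
  | obs {si sa : Any.{u}} {ti ta : Code.{u}} {fn : String} {args : Any.{u}}
      {ki ka : Any.{u} → Code.{u}}
      (hi : ti.observe = .vis _ (.obs fn args) ki) (ha : ta.observe = .vis _ (.obs fn args) ka)
      (h : ∀ r : Any.{u}, ∃ p' q', R p' q' (si, ki r) (sa, ka r)) :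
      SimF R p q (si, ti) (sa, ta)
  | step_i {ci ci' ca : Any.{u} × Code.{u}} (hi : LocalStep caller ci ci')
      (h : ∃ p' < p, ∃ q', R p' q' ci' ca) : SimF R p q ci ca
  | choose_i {si : Any.{u}} {ti : Code.{u}} {ca : Any.{u} × Code.{u}} {X : Type (u + 1)}
      {k : X → Code.{u}} (hi : ti.observe = .vis _ (.choose X) k)
      (h : ∀ x, ∃ p' < p, ∃ q', R p' q' (si, k x) ca) : SimF R p q (si, ti) ca
  | take_i {si : Any.{u}} {ti : Code.{u}} {ca : Any.{u} × Code.{u}} {X : Type (u + 1)}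
      {k : X → Code.{u}} (hi : ti.observe = .vis _ (.take X) k)
      (h : ∃ x, ∃ p' < p, ∃ q', R p' q' (si, k x) ca) : SimF R p q (si, ti) ca
  | step_a {ci ca ca' : Any.{u} × Code.{u}} (ha : LocalStep caller ca ca')
      (h : ∃ p', ∃ q' < q, R p' q' ci ca') : SimF R p q ci ca
  | choose_a {ci : Any.{u} × Code.{u}} {sa : Any.{u}} {ta : Code.{u}} {X : Type (u + 1)}
      {k : X → Code.{u}} (ha : ta.observe = .vis _ (.choose X) k)
      (h : ∃ x, ∃ p', ∃ q' < q, R p' q' ci (sa, k x)) : SimF R p q ci (sa, ta)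
  | take_a {ci : Any.{u} × Code.{u}} {sa : Any.{u}} {ta : Code.{u}} {X : Type (u + 1)}
      {k : X → Code.{u}} (ha : ta.observe = .vis _ (.take X) k)
      (h : ∀ x, ∃ p', ∃ q' < q, R p' q' ci (sa, k x)) : SimF R p q ci (sa, ta)

/-- The simulation relation: the greatest fixed point of `SimF`, with some stuttering indices. -/
def Sim (ci ca : Any.{u} × Code.{u}) : Prop :=
  ∃ R : Ordinal.{u + 1} → Ordinal.{u + 1} → Any.{u} × Code.{u} → Any.{u} × Code.{u} → Prop,
    (∀ p q ci ca, R p q ci ca → SimF I caller w₀ R p q ci ca) ∧ ∃ p q, R p q ci ca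

end Simulation

/-- `d` can be the global loading data of a program that contains a module with loading data
`ld`. -/
def IsGlobalLD {LD : Type v} [PCM LD] (ld d : LD) : Prop :=
  PCM.valid d ∧ ∃ c, d = ld + c

end AL

/-!
The proof lifts the simulation of function bodies to a simulation of whole executions.

Simulations of executions are sound for behaviors (`Behaves.of_stepSim`). A derivation of `BehF` for
the implementation is well-founded, so it can be replayed by induction on the derivation and, below
it, on the index `q`, which bounds the moves that the abstraction makes alone. The index `p` matters
for silent divergence only: by induction on `p`, the abstraction moves sooner or later while the
implementation spins, hence it spins too (`Spin.of_stepSim`). No determinacy of the game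
between system and environment is needed, since the simulation prescribes a move exactly where
the given derivation leaves the choice open.

The simulation of executions is `StateRel`. Both executions are in the same context function, or
both are in the module under refinement, with bodies related by the given simulation. The stores
agree except at that module, whose local states are related by the invariant at some world
whenever the context runs, and the stacks agree up to frames of the module (`StackRel`). A frame of the module was pushed at a
world `w₁`; it promises that its continuations are related whenever control comes back at a world
above `w₁`. As function bodies return at a world above the one at which they were called, the
promise can be redeemed. This also covers recursive calls and callbacks through the context.

Finally, well-formedness of the abstract program transfers to the implementation, and an
ill-formed abstract program has all traces.
-/

namespace AL

/-! ### Simulations of executions -/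

section StepSim

variable {Si : Type v} {Sa : Type w} (mi : Si → Move.{u} Si) (ma : Sa → Move.{u} Sa)

/-- One unfolding of a simulation of executions, in the cases in which the implementation moves:
either in lockstep with the abstraction, which may reset both indices, or alone, which decreases
`p`. -/
inductive ImplStep (R : Ordinal.{u + 1} → Ordinal.{u + 1} → Si → Sa → Prop)
    (p : Ordinal.{u + 1}) (s : Si) (t : Sa) : Prop
  | final {v : Any.{u}} (hi : mi s = .final v) (ha : ma t = .final v)
  | obs {fn : String} {args : Any.{u}} {ni : Any.{u} → Si} {na : Any.{u} → Sa}
      (hi : mi s = .obs fn args ni) (ha : ma t = .obs fn args na)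
      (h : ∀ r, ∃ p' q', R p' q' (ni r) (na r))
  | demonic {X : Type (u + 1)} {ni : X → Si} {na : X → Sa}
      (hi : mi s = .demonic X ni) (ha : ma t = .demonic X na)
      (h : ∀ x, ∃ p' q', R p' q' (ni x) (na x))
  | angelic {X : Type (u + 1)} {ni : X → Si} {na : X → Sa}
      (hi : mi s = .angelic X ni) (ha : ma t = .angelic X na)
      (h : ∀ x, ∃ p' q', R p' q' (ni x) (na x))
  | demonic_alone {X : Type (u + 1)} {ni : X → Si} (hi : mi s = .demonic X ni)
      (h : ∀ x, ∃ p' < p, ∃ q', R p' q' (ni x) t)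
  | angelic_alone {X : Type (u + 1)} {ni : X → Si} (hi : mi s = .angelic X ni)
      (h : ∃ x, ∃ p' < p, ∃ q', R p' q' (ni x) t)

/-- One unfolding of a simulation of executions, in the cases in which the abstraction moves alone,
which decreases `q`. -/
inductive AbsStep (R : Ordinal.{u + 1} → Ordinal.{u + 1} → Si → Sa → Prop)
    (q : Ordinal.{u + 1}) (s : Si) (t : Sa) : Prop
  | demonic {X : Type (u + 1)} {na : X → Sa} (ha : ma t = .demonic X na)
      (h : ∃ x, ∃ p', ∃ q' < q, R p' q' s (na x))
  | angelic {X : Type (u + 1)} {na : X → Sa} (ha : ma t = .angelic X na)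
      (h : ∀ x, ∃ p', ∃ q' < q, R p' q' s (na x))

/-- `R` is a simulation between two executions. -/
def IsStepSim (R : Ordinal.{u + 1} → Ordinal.{u + 1} → Si → Sa → Prop) : Prop :=
  ∀ p q s t, R p q s t → ImplStep mi ma R p s t ∨ AbsStep ma R q s t

variable {mi ma} {R : Ordinal.{u + 1} → Ordinal.{u + 1} → Si → Sa → Prop}

theorem spinF_of_stepSim (hR : IsStepSim mi ma R) {D : Si → Prop}
    (hD : ∀ s, D s → SpinF mi D s) (p : Ordinal.{u + 1}) :
    ∀ q s t, R p q s t → D s → SpinF ma (fun t => ∃ p q s, R p q s t ∧ D s) t := by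
  induction p using WellFoundedLT.induction with
  | ind p ih =>
  intro q s t h hs
  rcases hR p q s t h with h | h
  · cases h with
    | final hi ha => cases hD s hs <;> simp_all
    | obs hi ha h => cases hD s hs <;> simp_all
    | demonic hi ha h =>
      cases hD s hs with
      | demonic e x hx =>
        cases hi.symm.trans e
        obtain ⟨p', q', h'⟩ := h x
        exact .demonic ha x ⟨p', q', _, h', hx⟩
      | angelic e hx => cases hi.symm.trans e
    | angelic hi ha h =>
      cases hD s hs with
      | demonic e x hx => cases hi.symm.trans e
      | angelic e hx =>
        cases hi.symm.trans e
        refine .angelic ha fun x => ?_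
        obtain ⟨p', q', h'⟩ := h x
        exact ⟨p', q', _, h', hx x⟩
    | demonic_alone hi h =>
      cases hD s hs with
      | demonic e x hx =>
        cases hi.symm.trans e
        obtain ⟨p', hp, q', h'⟩ := h x
        exact ih p' hp q' _ t h' hx
      | angelic e hx => cases hi.symm.trans e
    | angelic_alone hi h =>
      cases hD s hs with
      | demonic e x hx => cases hi.symm.trans e
      | angelic e hx =>
        cases hi.symm.trans e
        obtain ⟨x, p', hp, q', h'⟩ := h
        exact ih p' hp q' _ t h' (hx x)
  · cases h with
    | demonic ha h =>
      obtain ⟨x, p', q', -, h'⟩ := h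
      exact .demonic ha x ⟨p', q', s, h', hs⟩
    | angelic ha h =>
      refine .angelic ha fun x => ?_
      obtain ⟨p', q', -, h'⟩ := h x
      exact ⟨p', q', s, h', hs⟩

theorem Spin.of_stepSim (hR : IsStepSim mi ma R) {p q : Ordinal.{u + 1}} {s : Si} {t : Sa}
    (h : R p q s t) (hs : Spin mi s) : Spin ma t := by
  obtain ⟨D, hD, hs⟩ := hs
  refine ⟨fun t => ∃ p q s, R p q s t ∧ D s, ?_, p, q, s, h, hs⟩
  rintro t ⟨p, q, s, h, hs⟩
  exact spinF_of_stepSim hR hD p q s t h hs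

/-- The moves that the abstraction makes alone can be skipped when a behavior is to be
established. -/
theorem behF_of_implStep (hR : IsStepSim mi ma R) {B : Sa → Trace.{u} → Prop} {s : Si}
    {tr : Trace.{u}} (H : ∀ p t, ImplStep mi ma R p s t → BehF ma B t tr)
    (q : Ordinal.{u + 1}) : ∀ p t, R p q s t → BehF ma B t tr := by
  induction q using WellFoundedLT.induction with
  | ind q ih =>
  intro p t h
  rcases hR p q s t h with h | h
  · exact H p t h
  · cases h with
    | demonic ha h =>
      obtain ⟨x, p', q', hq, h'⟩ := h
      exact .demonic ha x (ih q' hq p' _ h')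
    | angelic ha h =>
      refine .angelic ha fun x => ?_
      obtain ⟨p', q', hq, h'⟩ := h x
      exact ih q' hq p' _ h'

theorem BehF.of_stepSim (hR : IsStepSim mi ma R) {B : Si → Trace.{u} → Prop} {s : Si}
    {tr : Trace.{u}} (hs : BehF mi B s tr) : ∀ q p t, R p q s t →
      BehF ma (fun t tr => ∃ p q s, R p q s t ∧ B s tr) t tr := by
  induction hs with
  | term e =>
    refine behF_of_implStep hR fun p t h => ?_
    cases h with
    | final hi ha =>
      cases hi.symm.trans e
      exact .term ha
    | _ => simp_all
  | diverge hs => exact fun q p t h => .diverge (hs.of_stepSim hR h)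
  | stopped => exact fun _ _ _ _ => .stopped
  | obs e res tr hB =>
    refine behF_of_implStep hR fun p t h => ?_
    cases h with
    | obs hi ha h =>
      cases hi.symm.trans e
      obtain ⟨p', q', h'⟩ := h res
      exact .obs ha res tr ⟨p', q', _, h', hB⟩
    | _ => simp_all
  | demonic e x _ ih =>
    refine behF_of_implStep hR fun p t h => ?_
    cases h with
    | demonic hi ha h =>
      cases hi.symm.trans e
      obtain ⟨p', q', h'⟩ := h x
      exact .demonic ha x (ih q' p' _ h')
    | demonic_alone hi h =>
      cases hi.symm.trans e
      obtain ⟨p', -, q', h'⟩ := h x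
      exact ih q' p' _ h'
    | final hi | obs hi | angelic hi | angelic_alone hi => cases hi.symm.trans e
  | angelic e _ ih =>
    refine behF_of_implStep hR fun p t h => ?_
    cases h with
    | angelic hi ha h =>
      cases hi.symm.trans e
      refine .angelic ha fun x => ?_
      obtain ⟨p', q', h'⟩ := h x
      exact ih x q' p' _ h'
    | angelic_alone hi h =>
      cases hi.symm.trans e
      obtain ⟨x, p', -, q', h'⟩ := h
      exact ih x q' p' _ h'
    | final hi | obs hi | demonic hi | demonic_alone hi => cases hi.symm.trans e

/-- Simulations of executions are sound for behaviors. -/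
theorem Behaves.of_stepSim (hR : IsStepSim mi ma R) {p q : Ordinal.{u + 1}} {s : Si} {t : Sa}
    (h : R p q s t) {tr : Trace.{u}} (hs : Behaves mi s tr) : Behaves ma t tr := by
  obtain ⟨B, hB, hs⟩ := hs
  refine ⟨fun t tr => ∃ p q s, R p q s t ∧ B s tr, ?_, p, q, s, h, hs⟩
  rintro t tr ⟨p, q, s, h, hs⟩
  exact (hB s tr hs).of_stepSim hR q p t h

end StepSim

/-- A fatal error has all traces. -/
theorem behaves_error (P : List EMS.{u}) (tr : Trace.{u}) : Behaves (State.move P) .error tr :=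
  ⟨fun s _ => s = .error, by rintro _ _ rfl; exact .angelic rfl fun x => PEmpty.elim x, rfl⟩

/-! ### The simulation between two linked programs -/

section Linked

variable {W : Type w} [Preorder W] (J : W → Any.{u} → Any.{u} → Prop)

/-- The simulation of function bodies with its stuttering indices made explicit. -/
def SimAt (caller : String) (w₀ : W) (p q : Ordinal.{u + 1}) (ci ca : Any.{u} × Code.{u}) : Prop :=
  ∃ R : Ordinal.{u + 1} → Ordinal.{u + 1} → Any.{u} × Code.{u} → Any.{u} × Code.{u} → Prop,
    (∀ p q ci ca, R p q ci ca → SimF J caller w₀ R p q ci ca) ∧ R p q ci ca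

variable {J} in
theorem Sim.exists_simAt {caller : String} {w₀ : W} {ci ca : Any.{u} × Code.{u}}
    (h : Sim J caller w₀ ci ca) : ∃ p q, SimAt J caller w₀ p q ci ca := by
  obtain ⟨R, hR, p, q, h⟩ := h
  exact ⟨p, q, R, hR, h⟩

variable (N : String)

/-- Call stacks that are related at a world `w`: they are equal up to frames of the module `N`, and
such a frame, when resumed at a world above `w`, continues with related bodies. The frames below it
are related at the world `w₀` at which its function was called. -/
inductive StackRel : W → List Frame.{u} → List Frame.{u} → Prop
  | nil (w : W) : StackRel w [] []
  | context {w : W} {stki stka : List Frame.{u}} (F : Frame.{u}) (hF : F.modName ≠ N)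
      (h : StackRel w stki stka) : StackRel w (F :: stki) (F :: stka)
  | module {w w₀ : W} {stki stka : List Frame.{u}} (caller : String)
      {ki ka : Any.{u} → Code.{u}} (h : StackRel w₀ stki stka)
      (hk : ∀ (r : Any.{u}) (w' : W) (si sa : Any.{u}), w ≤ w' → J w' si sa →
        Sim J caller w₀ (si, ki r) (sa, ka r)) :
      StackRel w (⟨N, caller, ki⟩ :: stki) (⟨N, caller, ka⟩ :: stka)

/-- States of two executions that are related, with stuttering indices. The module under
refinement has the name `N`, and the invariant `J` on its local states is known to hold only while
the context executes. -/
inductive StateRel (p q : Ordinal.{u + 1}) : State.{u} → State.{u} → Prop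
  | error : StateRel p q .error .error
  | context {m caller : String} {t : Code.{u}} {stki stka : List Frame.{u}}
      {σi σa : String → Any.{u}} {w : W} (hm : m ≠ N) (hσ : ∀ m ≠ N, σi m = σa m)
      (hJ : J w (σi N) (σa N)) (hstk : StackRel J N w stki stka) :
      StateRel p q (.run m caller t stki σi) (.run m caller t stka σa)
  | module {caller : String} {ti ta : Code.{u}} {stki stka : List Frame.{u}}
      {σi σa : String → Any.{u}} {w₀ : W} (hσ : ∀ m ≠ N, σi m = σa m)
      (hstk : StackRel J N w₀ stki stka)
      (hsim : SimAt J caller w₀ p q (σi N, ti) (σa N, ta)) :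
      StateRel p q (.run N caller ti stki σi) (.run N caller ta stka σa)

variable {J N}

theorem StackRel.mono {w w' : W} (hw : w ≤ w') {stki stka : List Frame.{u}}
    (h : StackRel J N w stki stka) : StackRel J N w' stki stka := by
  induction h with
  | nil => exact .nil _
  | context F hF _ ih => exact .context F hF (ih hw)
  | module caller h hk => exact .module caller h fun r v si sa hv => hk r v si sa (hw.trans hv)

theorem Sim.exists_stateRel {caller : String} {ti ta : Code.{u}} {stki stka : List Frame.{u}}
    {σi σa : String → Any.{u}} {w₀ : W} (hσ : ∀ m ≠ N, σi m = σa m)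
    (hstk : StackRel J N w₀ stki stka) (hsim : Sim J caller w₀ (σi N, ti) (σa N, ta)) :
    ∃ p q, StateRel J N p q (.run N caller ti stki σi) (.run N caller ta stka σa) := by
  obtain ⟨p, q, h⟩ := hsim.exists_simAt
  exact ⟨p, q, .module hσ hstk h⟩

/-- A local step of a function body is a silent step of the execution. -/
theorem LocalStep.exists_move (P : List EMS.{u}) {caller : String} {st st' : Any.{u}}
    {t t' : Code.{u}} (h : LocalStep caller (st, t) (st', t')) (stk : List Frame.{u})
    {σ : String → Any.{u}} (hst : σ N = st) :
    ∃ σ' : String → Any.{u}, (∀ m ≠ N, σ' m = σ m) ∧ σ' N = st' ∧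
      State.move P (.run N caller t stk σ) = .silent (.run N caller t' stk σ') := by
  subst hst
  cases h with
  | tau h => exact ⟨σ, fun _ _ => rfl, rfl, by simp only [State.move, h]⟩
  | get h => exact ⟨σ, fun _ _ => rfl, rfl, by simp only [State.move, h]⟩
  | put h =>
    exact ⟨Function.update σ N st', fun m hm => Function.update_of_ne hm _ _,
      Function.update_self _ _ _, by simp only [State.move, h]⟩
  | getCaller h => exact ⟨σ, fun _ _ => rfl, rfl, by simp only [State.move, h]⟩

variable (J N) in
/-- Two loaded programs have matching functions: a function name is undefined in both, or has the
same definition outside of the module `N`, or is defined in that module by two functions that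
simulate each other. -/
def FunsMatch (Pi Pa : List EMS.{u}) : Prop :=
  ∀ fn, (findFun Pi fn = none ∧ findFun Pa fn = none) ∨
    (∃ m f, m ≠ N ∧ findFun Pi fn = some (m, f) ∧ findFun Pa fn = some (m, f)) ∨
    ∃ fi fa, findFun Pi fn = some (N, fi) ∧ findFun Pa fn = some (N, fa) ∧
      ∀ (caller : String) (args : Any.{u}) (w₀ : W) (si sa : Any.{u}), J w₀ si sa →
        Sim J caller w₀ (si, fi args) (sa, fa args)

variable {Pi Pa : List EMS.{u}}

theorem FunsMatch.invoke (hP : FunsMatch J N Pi Pa) (caller fn : String) (args : Any.{u})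
    {stki stka : List Frame.{u}} {σi σa : String → Any.{u}} {w : W} (hσ : ∀ m ≠ N, σi m = σa m)
    (hJ : J w (σi N) (σa N)) (hstk : StackRel J N w stki stka) :
    ∃ p q, StateRel J N p q (invoke Pi caller fn args stki σi)
      (invoke Pa caller fn args stka σa) := by
  rcases hP fn with ⟨hi, ha⟩ | ⟨m, f, hm, hi, ha⟩ | ⟨fi, fa, hi, ha, hf⟩
  · simp only [AL.invoke, hi, ha]
    exact ⟨0, 0, .error⟩
  · simp only [AL.invoke, hi, ha]
    exact ⟨0, 0, .context hm hσ hJ hstk⟩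
  · simp only [AL.invoke, hi, ha]
    exact (hf caller args w _ _ hJ).exists_stateRel hσ hstk

theorem ImplStep.of_silent {Si : Type v} {Sa : Type w} {mi : Si → Move.{u} Si}
    {ma : Sa → Move.{u} Sa} {R : Ordinal.{u + 1} → Ordinal.{u + 1} → Si → Sa → Prop}
    {p : Ordinal.{u + 1}} {s s' : Si} {t t' : Sa} (hi : mi s = .silent s')
    (ha : ma t = .silent t') (h : ∃ p' q', R p' q' s' t') : ImplStep mi ma R p s t :=
  .demonic hi ha fun _ => h

/-- Both bodies return the same value, at a world at which the invariant holds and the stacks are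
related. -/
theorem implStep_ret {m caller : String} {ti ta : Code.{u}} {v : Any.{u}}
    (hi : ti.observe = .ret v) (ha : ta.observe = .ret v) {stki stka : List Frame.{u}}
    {σi σa : String → Any.{u}} {w : W} (hσ : ∀ m ≠ N, σi m = σa m) (hJ : J w (σi N) (σa N))
    (hstk : StackRel J N w stki stka) (p : Ordinal.{u + 1}) :
    ImplStep (State.move Pi) (State.move Pa) (StateRel J N) p
      (.run m caller ti stki σi) (.run m caller ta stka σa) := by
  cases hstk with
  | nil => exact .final (by simp only [State.move, hi]; rfl) (by simp only [State.move, ha])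
  | context F hF h =>
    exact .of_silent (by simp only [State.move, hi]; rfl) (by simp only [State.move, ha])
      ⟨0, 0, .context hF hσ hJ h⟩
  | module caller h hk =>
    exact .of_silent (by simp only [State.move, hi]) (by simp only [State.move, ha])
      ((hk v w _ _ le_rfl hJ).exists_stateRel hσ h)

/-- Two executions of the same context function move in lockstep. -/
theorem FunsMatch.implStep_context (hP : FunsMatch J N Pi Pa) {m caller : String} {t : Code.{u}}
    {stki stka : List Frame.{u}} {σi σa : String → Any.{u}} {w : W} (hm : m ≠ N)
    (hσ : ∀ m ≠ N, σi m = σa m) (hJ : J w (σi N) (σa N)) (hstk : StackRel J N w stki stka)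
    (p : Ordinal.{u + 1}) :
    ImplStep (State.move Pi) (State.move Pa) (StateRel J N) p
      (.run m caller t stki σi) (.run m caller t stka σa) := by
  have next (t' : Code.{u}) :
      ∃ p q, StateRel J N p q (.run m caller t' stki σi) (.run m caller t' stka σa) :=
    ⟨0, 0, .context hm hσ hJ hstk⟩
  cases ht : t.observe with
  | ret v => exact implStep_ret ht ht hσ hJ hstk p
  | tau t' =>
    exact .of_silent (by simp only [State.move, ht]) (by simp only [State.move, ht]) (next t')
  | vis X e k =>
    cases e with
    | choose =>
      exact .demonic (by simp only [State.move, ht]) (by simp only [State.move, ht])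
        fun x => next (k x)
    | take =>
      exact .angelic (by simp only [State.move, ht]) (by simp only [State.move, ht])
        fun x => next (k x)
    | obs fn args =>
      exact .obs (by simp only [State.move, ht]; rfl) (by simp only [State.move, ht])
        fun r => next (k r)
    | call fn args =>
      exact .of_silent (by simp only [State.move, ht]; rfl) (by simp only [State.move, ht])
        (hP.invoke m fn args hσ hJ (.context _ hm hstk))
    | get =>
      exact .of_silent (by simp only [State.move, ht]; rfl) (by simp only [State.move, ht, hσ m hm])
        (next _)
    | put a =>
      refine .of_silent (by simp only [State.move, ht]; rfl) (by simp only [State.move, ht]; rfl)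
        ⟨0, 0, .context (w := w) hm (fun m' hm' => ?_) ?_ hstk⟩
      · by_cases h : m' = m
        · subst h
          simp only [Function.update_self]
        · simp only [Function.update_of_ne h, hσ m' hm']
      · simpa only [Function.update_of_ne hm.symm] using hJ
    | getCaller =>
      exact .of_silent (by simp only [State.move, ht]; rfl) (by simp only [State.move, ht]) (next _)

/-- Two executions of the module under refinement follow the simulation of its function bodies. -/
theorem FunsMatch.step_module (hP : FunsMatch J N Pi Pa) {p q : Ordinal.{u + 1}} {caller : String}
    {ti ta : Code.{u}} {stki stka : List Frame.{u}} {σi σa : String → Any.{u}} {w₀ : W}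
    (hσ : ∀ m ≠ N, σi m = σa m) (hstk : StackRel J N w₀ stki stka)
    (hsim : SimAt J caller w₀ p q (σi N, ti) (σa N, ta)) :
    ImplStep (State.move Pi) (State.move Pa) (StateRel J N) p
        (.run N caller ti stki σi) (.run N caller ta stka σa) ∨
      AbsStep (State.move Pa) (StateRel J N) q
        (.run N caller ti stki σi) (.run N caller ta stka σa) := by
  obtain ⟨R, hR, h⟩ := hsim
  have next {p' q' : Ordinal.{u + 1}} {ti' ta' : Code.{u}} (h : R p' q' (σi N, ti') (σa N, ta')) :
      StateRel J N p' q' (.run N caller ti' stki σi) (.run N caller ta' stka σa) :=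
    .module hσ hstk ⟨R, hR, h⟩
  generalize hsi : σi N = si at h
  generalize hsa : σa N = sa at h
  cases hR p q _ _ h with
  | ret hi ha w₁ hw hI =>
    subst hsi hsa
    exact .inl (implStep_ret hi ha hσ hI (hstk.mono hw) p)
  | call hi ha w₁ hw hI hk =>
    subst hsi hsa
    refine .inl (.of_silent (by simp only [State.move, hi]; rfl) (by simp only [State.move, ha]; rfl)
      (hP.invoke N _ _ hσ hI (.module caller hstk fun r w' si sa hw' hJ => ?_)))
    exact ⟨R, hR, hk r w' si sa hw' hJ⟩
  | obs hi ha hk =>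
    subst hsi hsa
    refine .inl (.obs (by simp only [State.move, hi]; rfl) (by simp only [State.move, ha]; rfl)
      fun r => ?_)
    obtain ⟨p', q', h'⟩ := hk r
    exact ⟨p', q', next h'⟩
  | @step_i _ ci' _ hi hk =>
    obtain ⟨p', hp, q', h'⟩ := hk
    obtain ⟨st', t'⟩ := ci'
    obtain ⟨σ', hσ', rfl, hmove⟩ := hi.exists_move Pi stki hsi
    subst hsa
    exact .inl (.demonic_alone hmove fun _ => ⟨p', hp, q',
      .module (fun m hm => (hσ' m hm).trans (hσ m hm)) hstk ⟨R, hR, h'⟩⟩)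
  | choose_i hi hk =>
    subst hsi hsa
    refine .inl (.demonic_alone (by simp only [State.move, hi]; rfl) fun x => ?_)
    obtain ⟨p', hp, q', h'⟩ := hk x
    exact ⟨p', hp, q', next h'⟩
  | take_i hi hk =>
    subst hsi hsa
    obtain ⟨x, p', hp, q', h'⟩ := hk
    exact .inl (.angelic_alone (by simp only [State.move, hi]; rfl) ⟨x, p', hp, q', next h'⟩)
  | @step_a _ _ ca' ha hk =>
    obtain ⟨p', q', hq, h'⟩ := hk
    obtain ⟨st', t'⟩ := ca'
    obtain ⟨σ', hσ', rfl, hmove⟩ := ha.exists_move Pa stka hsa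
    subst hsi
    exact .inr (.demonic hmove ⟨PUnit.unit, p', q', hq,
      .module (fun m hm => (hσ m hm).trans (hσ' m hm).symm) hstk ⟨R, hR, h'⟩⟩)
  | choose_a ha hk =>
    subst hsi hsa
    obtain ⟨x, p', q', hq, h'⟩ := hk
    exact .inr (.demonic (by simp only [State.move, ha]; rfl) ⟨x, p', q', hq, next h'⟩)
  | take_a ha hk =>
    subst hsi hsa
    refine .inr (.angelic (by simp only [State.move, ha]; rfl) fun x => ?_)
    obtain ⟨p', q', hq, h'⟩ := hk x
    exact ⟨p', q', hq, next h'⟩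

theorem FunsMatch.isStepSim (hP : FunsMatch J N Pi Pa) :
    IsStepSim (State.move Pi) (State.move Pa) (StateRel J N) := by
  intro p q s t h
  cases h with
  | error => exact .inl (.angelic rfl rfl fun x => PEmpty.elim x)
  | context hm hσ hJ hstk => exact .inl (hP.implStep_context hm hσ hJ hstk p)
  | module hσ hstk hsim => exact hP.step_module hσ hstk hsim

end Linked

/-! ### Loading -/

section Loading

theorem findFun_append_singleton (L : List EMS.{u}) (M : EMS.{u}) (fn : String) :
    findFun (L ++ [M]) fn = (findFun L fn).or ((M.funs fn).map fun f => (M.name, f)) := by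
  simp only [findFun, List.findSome?_append, List.findSome?_singleton]

theorem exists_mem_of_findFun {L : List EMS.{u}} {fn m : String} {f : Fundef.{u}}
    (h : findFun L fn = some (m, f)) : ∃ M ∈ L, M.name = m := by
  obtain ⟨M, hM, h⟩ := List.exists_of_findSome?_eq_some h
  obtain ⟨_, -, h⟩ := Option.map_eq_some_iff.1 h
  exact ⟨M, hM, congrArg Prod.fst h⟩

theorem funsMatch_append_singleton {W : Type w} [Preorder W] {J : W → Any.{u} → Any.{u} → Prop}
    {L : List EMS.{u}} {Mi Ma : EMS.{u}} (hname : Mi.name = Ma.name)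
    (hL : ∀ M ∈ L, M.name ≠ Ma.name)
    (hdom : ∀ fn, (Mi.funs fn).isSome ↔ (Ma.funs fn).isSome)
    (hsim : ∀ fn fi fa, Mi.funs fn = some fi → Ma.funs fn = some fa →
      ∀ (caller : String) (args : Any.{u}) (w₀ : W) (si sa : Any.{u}), J w₀ si sa →
        Sim J caller w₀ (si, fi args) (sa, fa args)) :
    FunsMatch J Ma.name (L ++ [Mi]) (L ++ [Ma]) := by
  intro fn
  simp only [findFun_append_singleton, hname]
  have hfn := hdom fn
  cases hc : findFun L fn with
  | some mf =>
    obtain ⟨M, hM, h⟩ := exists_mem_of_findFun (m := mf.1) (f := mf.2) hc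
    exact .inr (.inl ⟨mf.1, mf.2, h ▸ hL M hM, rfl, rfl⟩)
  | none =>
    cases hi : Mi.funs fn with
    | none =>
      cases ha : Ma.funs fn with
      | none => exact .inl ⟨rfl, rfl⟩
      | some fa => simp [hi, ha] at hfn
    | some fi =>
      cases ha : Ma.funs fn with
      | none => simp [hi, ha] at hfn
      | some fa => exact .inr (.inr ⟨fi, fa, rfl, rfl, hsim fn fi fa hi ha⟩)

theorem initStore_append_singleton_of_ne (L : List EMS.{u}) (Mi Ma : EMS.{u}) {m : String}
    (hi : Mi.name ≠ m) (ha : Ma.name ≠ m) :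
    initStore (L ++ [Mi]) m = initStore (L ++ [Ma]) m := by
  simp [initStore, List.find?_append, hi, ha]

theorem initStore_append_singleton_self {L : List EMS.{u}} {M : EMS.{u}}
    (hL : ∀ M' ∈ L, M'.name ≠ M.name) : initStore (L ++ [M]) M.name = M.init := by
  have h : (L.find? fun M' => M'.name = M.name) = none := by
    simpa [List.find?_eq_none] using hL
  simp [initStore, List.find?_append, h]

variable {LD : Type v} [PCM LD]

theorem Mods.ld_append_singleton (C : Mods.{u} LD) (M : Mod.{u} LD) :
    Mods.ld (C ++ [M]) = C.ld + M.ld := by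
  simp [Mods.ld]

theorem Mods.load_append_singleton (C : Mods.{u} LD) (M : Mod.{u} LD) :
    Mods.load (C ++ [M]) = (C.map fun m => m.sem (C.ld + M.ld)) ++ [M.sem (C.ld + M.ld)] := by
  simp [Mods.load, Mods.ld_append_singleton]

end Loading

end AL

theorem theorem4p1 {LD : Type v} [AL.PCM LD] {W : Type w} [Preorder W]
    (Mi Ma : AL.Mod.{u} LD)
    (I : LD → W → AL.Any.{u} → AL.Any.{u} → Prop)
    (hld : Mi.ld = Ma.ld)
    (hname : ∀ d, AL.IsGlobalLD Mi.ld d → (Mi.sem d).name = (Ma.sem d).name)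
    (hdom : ∀ d, AL.IsGlobalLD Mi.ld d →
      ∀ fn, ((Mi.sem d).funs fn).isSome ↔ ((Ma.sem d).funs fn).isSome)
    (hinit : ∀ d, AL.IsGlobalLD Mi.ld d → ∃ w₀, I d w₀ (Mi.sem d).init (Ma.sem d).init)
    (hsim : ∀ d, AL.IsGlobalLD Mi.ld d →
      ∀ fn fi fa, (Mi.sem d).funs fn = some fi → (Ma.sem d).funs fn = some fa →
        ∀ (caller : String) (args : AL.Any.{u}) (w₀ : W) (si sa : AL.Any.{u}), I d w₀ si sa →
          AL.Sim (I d) caller w₀ (si, fi args) (sa, fa args))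
    (main : AL.MainCall.{u}) :
    AL.CtxRefines main [Mi] [Ma] := by
  intro C tr htr
  by_cases hwf : AL.Mods.Wf (C ++ [Ma])
  swap
  · -- An ill-formed abstract program starts in the error state, which has all traces.
    simp only [AL.Mods.Beh, AL.Mods.start, if_neg hwf, Set.mem_ofPred_eq]
    exact AL.behaves_error _ tr
  have ⟨hvalid, hnames, hfuns⟩ := hwf
  rw [AL.Mods.ld_append_singleton, ← hld] at hvalid
  have hd : AL.IsGlobalLD Mi.ld (C.ld + Mi.ld) := ⟨hvalid, C.ld, add_comm _ _⟩
  have hvalidi : AL.PCM.valid (AL.Mods.ld (C ++ [Mi])) := by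
    rwa [AL.Mods.ld_append_singleton]
  have hloadi := AL.Mods.load_append_singleton C Mi
  have hloada := AL.Mods.load_append_singleton C Ma
  rw [← hld] at hloada
  rw [hloada] at hnames hfuns
  specialize hname _ hd
  specialize hdom _ hd
  obtain ⟨w₀, hw₀⟩ := hinit _ hd
  specialize hsim _ hd
  generalize C.ld + Mi.ld = d at *
  generalize (C.map fun m => m.sem d) = L at *
  rw [List.pairwise_append] at hnames hfuns
  have hL : ∀ M ∈ L, M.name ≠ (Ma.sem d).name := fun M hM =>
    hnames.2.2 M hM _ (List.mem_singleton_self _)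
  -- The names and the domains of the two modules agree, so the concrete program is well-formed.
  have hwfi : AL.Mods.Wf (C ++ [Mi]) := by
    refine ⟨hvalidi, ?_, ?_⟩
    · rw [hloadi, List.pairwise_append]
      refine ⟨hnames.1, List.pairwise_singleton _ _, fun M hM M' hM' => ?_⟩
      rw [List.mem_singleton.1 hM', hname]
      exact hL M hM
    · rw [hloadi, List.pairwise_append]
      refine ⟨hfuns.1, List.pairwise_singleton _ _, fun M hM M' hM' fn => ?_⟩
      rw [List.mem_singleton.1 hM']
      have h := hfuns.2.2 M hM _ (List.mem_singleton_self _) fn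
      rwa [← Option.not_isSome_iff_eq_none (o := (Ma.sem d).funs fn), ← hdom fn,
        Option.not_isSome_iff_eq_none] at h
  simp only [AL.Mods.Beh, AL.Mods.start, if_pos hwf, if_pos hwfi, hloadi, hloada,
    Set.mem_ofPred_eq] at htr ⊢
  have hP := AL.funsMatch_append_singleton hname hL hdom hsim
  obtain ⟨p, q, h⟩ := hP.invoke main.caller main.fn main.args (stki := []) (stka := [])
    (σi := AL.initStore (L ++ [Mi.sem d])) (σa := AL.initStore (L ++ [Ma.sem d])) (w := w₀)
    (fun m hm => AL.initStore_append_singleton_of_ne L _ _ (hname ▸ hm.symm) hm.symm)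
    (by
      rw [AL.initStore_append_singleton_self hL, ← hname, AL.initStore_append_singleton_self
        (hname ▸ hL)]
      exact hw₀)
    (.nil _)
  exact htr.of_stepSim hP.isStepSim h
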